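/- Let $(M,g)$ be a space-time domain: a connected smooth 4-manifold with a smooth Lorentzian metric of signature $(-,+,+,+)$. Let $T=(\rho+p)\,u\otimes u+p\,g$ be a perfect energy tensor on it, i.e. $u$ is a smooth vector field with $g(u,u)=-1$, $\rho$ and $p$ are smooth functions, and $\nabla\cdot T=0$. Write $\dot q=u(q)$ for a function $q$. Suppose that $T$ is non-barotropic (it is not the case that $d\rho\wedge dp=0$ on all of $M$) and non-isoenergetic ($\dot\rho\neq 0$ everywhere). We say that $T$ represents the local-thermal-equilibrium evolution of a classical ideal gas with constants $k,c_v>0$, matter density $n$, specific internal energy $\epsilon$, temperature $\Theta$ and specific entropy $s$ if $n,\epsilon,\Theta,s$ are smooth functions on $M$ with $n>0$, $\Theta>0$ and $$\rho=n(1+\epsilon),\qquad \nabla\cdot(nu)=0,\qquad \Theta\,ds=d\epsilon+p\,d(1/n),\qquad p=kn\Theta,\qquad \epsilon=c_v\Theta .$$ The adiabatic index of the gas is $1+k/c_v$. Let $\gamma$ be a real number. (a) $T$ represents the local-thermal-equilibrium evolution of some classical ideal gas with adiabatic index $\gamma$ if and only if $\gamma>1$ and $0<p<(\gamma-1)\rho$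 everywhere (the positivity constraints) and the indicatrix function $\chi=\dot p/\dot\rho$ is $$\chi=\frac{\gamma p}{\rho+p}\quad\text{everywhere.}$$ In particular, when the positivity constraints hold, $T$ represents such an evolution if and only if $\chi=\gamma p/(\rho+p)$. (b) In that case, for all real $k,c_v$ and all functions $n,\epsilon,\Theta,s$ on $M$, $T$ represents the evolution of the classical ideal gas with these constants and thermodynamic quantities if and only if $c_v>0$, $\gamma=1+k/c_v$ and $$n=\rho-\frac{p}{\gamma-1},\qquad \epsilon=\frac{p}{(\gamma-1)\rho-p},\qquad \Theta=\frac{\epsilon}{c_v},\qquad s=s_0+c_v\ln\frac{p}{[\rho(\gamma-1)-p]^{\gamma}}$$ for some real constant $s_0$. -/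

import Mathlib

open scoped Manifold ContDiff Bundle

noncomputable section

namespace PerfectFluid

/-- The model vector space of a space-time. -/
abbrev E4 : Type := EuclideanSpace ℝ (Fin 4)

variable {M : Type*} [TopologicalSpace M] [ChartedSpace E4 M]

/-! ### Vector fields, differentials -/

variable (M) in
/-- Vector fields (with no regularity). -/
abbrev VField : Type _ := ∀ x : M, TangentSpace (𝓡 4) x

/-- The differential of a scalar function at a point. -/
abbrev diff (f : M → ℝ) (x : M) : TangentSpace (𝓡 4) x →L[ℝ] ℝ := mvfderiv (𝓡 4) f x

/-- Smooth real functions on `M`. -/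
abbrev SmoothFun (f : M → ℝ) : Prop := ContMDiff (𝓡 4) 𝓘(ℝ, ℝ) ∞ f

/-- Scalar functions differentiable at a point. -/
abbrev FunDiffAt (f : M → ℝ) (x : M) : Prop := MDifferentiableAt (𝓡 4) 𝓘(ℝ, ℝ) f x

variable [IsManifold (𝓡 4) ∞ M]

/-- Smooth vector fields on `M`. -/
abbrev SmoothField (X : VField M) : Prop :=
  ContMDiff (𝓡 4) ((𝓡 4).prod 𝓘(ℝ, E4)) ∞ (fun y ↦ Bundle.TotalSpace.mk' E4 y (X y))

/-- Vector fields differentiable at a point. -/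
abbrev FieldDiffAt (X : VField M) (x : M) : Prop :=
  MDifferentiableAt (𝓡 4) ((𝓡 4).prod 𝓘(ℝ, E4)) (fun y ↦ Bundle.TotalSpace.mk' E4 y (X y)) x

/-! ### Lorentzian metrics and the Levi-Civita connection -/

variable (M) in
/-- A smooth Lorentzian metric, of signature `(-,+,+,+)`, on a 4-dimensional manifold. -/
structure LorentzMetric where
  /-- The bilinear form on each tangent space. -/
  val : ∀ x : M, TangentSpace (𝓡 4) x →L[ℝ] TangentSpace (𝓡 4) x →L[ℝ] ℝ
  symm : ∀ (x : M) (v w : TangentSpace (𝓡 4) x), val x v w = val x w v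
  signature : ∀ x : M, ∃ b : Module.Basis (Fin 4) ℝ (TangentSpace (𝓡 4) x), ∀ i j,
    val x (b i) (b j) = if i = j then (if i = 0 then -1 else 1) else 0
  contMDiff : ContMDiff (𝓡 4) ((𝓡 4).prod 𝓘(ℝ, E4 →L[ℝ] E4 →L[ℝ] ℝ)) ∞
    (fun x ↦ Bundle.TotalSpace.mk' (E4 →L[ℝ] E4 →L[ℝ] ℝ) x (val x))

namespace LorentzMetric

variable (g : LorentzMetric M)

theorem nondegenerate (x : M) (v : TangentSpace (𝓡 4) x) (hv : ∀ w, g.val x v w = 0) : v = 0 := by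
  obtain ⟨b, hb⟩ := g.signature x
  rw [← b.sum_repr v]
  refine Finset.sum_eq_zero fun j _ ↦ ?_
  have h := hv (b j)
  rw [← b.sum_repr v] at h
  simp only [map_sum, map_smul, sum_apply, smul_apply, hb, smul_eq_mul, mul_ite, mul_zero] at h
  simp only [Finset.sum_ite_eq', Finset.mem_univ, if_true] at h
  have : b.repr v j = 0 := by
    split_ifs at h <;> linarith
  simp [this]

theorem val_neg_left (x : M) (v w : TangentSpace (𝓡 4) x) :
    g.val x (-v) w = -g.val x v w := by
  rw [← neg_one_smul ℝ v, map_smul, smul_apply, smul_eq_mul]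
  ring

theorem diffAt_val {x : M} {X Y : VField M} (hX : FieldDiffAt X x) (hY : FieldDiffAt Y x) :
    FunDiffAt (fun y ↦ g.val y (X y) (Y y)) x := by
  have : MDifferentiableAt (𝓡 4) ((𝓡 4).prod 𝓘(ℝ))
      (fun m ↦ Bundle.TotalSpace.mk' ℝ (E := Bundle.Trivial M ℝ) m (g.val m (X m) (Y m))) x :=
    MDifferentiableAt.clm_bundle_apply₂ (F₁ := E4) (F₂ := E4)
      (g.contMDiff.mdifferentiableAt (by simp)) hX hY
  simp only [mdifferentiableAt_totalSpace] at this
  exact this.2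

/-- The Koszul expression: `2 g(∇_X Y, Z)` for the Levi-Civita connection `∇`. -/
def koszul (X Y Z : VField M) (x : M) : ℝ :=
  diff (fun y ↦ g.val y (Y y) (Z y)) x (X x)
    + diff (fun y ↦ g.val y (X y) (Z y)) x (Y x)
    - diff (fun y ↦ g.val y (X y) (Y y)) x (Z x)
    + g.val x (VectorField.mlieBracket (𝓡 4) X Y x) (Z x)
    - g.val x (VectorField.mlieBracket (𝓡 4) X Z x) (Y x)
    - g.val x (VectorField.mlieBracket (𝓡 4) Y Z x) (X x)

theorem koszul_tensorial₁ {x : M} {Y Z : VField M} (hY : FieldDiffAt Y x) (hZ : FieldDiffAt Z x) :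
    TensorialAt (𝓡 4) E4 (fun X ↦ g.koszul X Y Z x) x where
  smul {f X} hf hX := by
    simp [koszul, VectorField.mlieBracket_smul_left hf hX,
      mvfderiv_fun_mul hf (g.diffAt_val hX hY), mvfderiv_fun_mul hf (g.diffAt_val hX hZ), diff]
    rw [g.symm x (X x) (Z x), g.symm x (X x) (Y x)]
    ring
  add {X X'} hX hX' := by
    simp [koszul, VectorField.mlieBracket_add_left hX hX',
      mvfderiv_fun_add (g.diffAt_val hX hY) (g.diffAt_val hX' hY),
      mvfderiv_fun_add (g.diffAt_val hX hZ) (g.diffAt_val hX' hZ), diff]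
    ring

theorem koszul_tensorial₃ {x : M} {X Y : VField M} (hX : FieldDiffAt X x) (hY : FieldDiffAt Y x) :
    TensorialAt (𝓡 4) E4 (fun Z ↦ g.koszul X Y Z x) x where
  smul {f Z} hf hZ := by
    simp [koszul, VectorField.mlieBracket_smul_right hf hZ,
      mvfderiv_fun_mul hf (g.diffAt_val hX hZ), mvfderiv_fun_mul hf (g.diffAt_val hY hZ), diff]
    rw [g.symm x (Z x) (X x), g.symm x (Z x) (Y x)]
    ring
  add {Z Z'} hZ hZ' := by
    simp [koszul, VectorField.mlieBracket_add_right hZ hZ',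
      mvfderiv_fun_add (g.diffAt_val hX hZ) (g.diffAt_val hX hZ'),
      mvfderiv_fun_add (g.diffAt_val hY hZ) (g.diffAt_val hY hZ'), diff]
    ring

theorem koszul_add {x : M} {X Y Y' Z : VField M} (hX : FieldDiffAt X x) (hY : FieldDiffAt Y x)
    (hY' : FieldDiffAt Y' x) (hZ : FieldDiffAt Z x) :
    g.koszul X (Y + Y') Z x = g.koszul X Y Z x + g.koszul X Y' Z x := by
  simp [koszul, VectorField.mlieBracket_add_right hY hY', VectorField.mlieBracket_add_left hY hY',
      mvfderiv_fun_add (g.diffAt_val hX hY) (g.diffAt_val hX hY'),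
      mvfderiv_fun_add (g.diffAt_val hY hZ) (g.diffAt_val hY' hZ), diff]
  ring

theorem koszul_smul {x : M} {X Y Z : VField M} {f : M → ℝ} (hf : FunDiffAt f x)
    (hX : FieldDiffAt X x) (hY : FieldDiffAt Y x) (hZ : FieldDiffAt Z x) :
    g.koszul X (f • Y) Z x
      = f x * g.koszul X Y Z x + 2 * (diff f x (X x) * g.val x (Y x) (Z x)) := by
  simp [koszul, VectorField.mlieBracket_smul_right hf hY, VectorField.mlieBracket_smul_left hf hY,
      mvfderiv_fun_mul hf (g.diffAt_val hX hY), mvfderiv_fun_mul hf (g.diffAt_val hY hZ), diff]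
  rw [g.symm x (Y x) (X x)]
  ring

/-- The metric at a point, as an isomorphism of the tangent space with its dual. -/
def flat (x : M) : TangentSpace (𝓡 4) x ≃ₗ[ℝ] (TangentSpace (𝓡 4) x →L[ℝ] ℝ) :=
  LinearEquiv.ofBijective (g.val x).toLinearMap (by
    have hinj : Function.Injective (g.val x).toLinearMap := by
      rw [← LinearMap.ker_eq_bot, LinearMap.ker_eq_bot']
      intro v hv
      exact g.nondegenerate x v fun w ↦ congrArg (fun φ ↦ φ w) hv
    have hdim : Module.finrank ℝ E4 = Module.finrank ℝ (E4 →L[ℝ] ℝ) :=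
      (Subspace.dual_finrank_eq (K := ℝ) (V := E4)).symm.trans
        (LinearMap.toContinuousLinearMap (𝕜 := ℝ) (E := E4) (F' := ℝ)).finrank_eq
    exact ⟨hinj, (LinearMap.injective_iff_surjective_of_finrank_eq_finrank
      (V := E4) (V₂ := E4 →L[ℝ] ℝ) hdim).1 hinj⟩)

/-- A linear endomorphism of the model space is continuous. -/
def linToCLM (f : E4 →ₗ[ℝ] E4) : E4 →L[ℝ] E4 := LinearMap.toContinuousLinearMap f

/-- The linear map `X ↦ ∇_X Y` at a point where `Y` is differentiable: it is determined by the
Koszul formula `2 g(∇_X Y, Z) = koszul X Y Z`. -/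
def nablaAux {Y : VField M} {x : M} (hY : FieldDiffAt Y x) :
    TangentSpace (𝓡 4) x →L[ℝ] TangentSpace (𝓡 4) x :=
  linToCLM
    (((1 / 2 : ℝ) • (g.flat x).symm.toLinearMap).comp
      (TensorialAt.mkHom₂ (I := 𝓡 4) (F := E4) (F' := E4) (fun X Z ↦ g.koszul X Y Z x) x
        (fun _ hZ ↦ g.koszul_tensorial₁ hY hZ)
        (fun _ hX ↦ g.koszul_tensorial₃ hX hY)).toLinearMap)

theorem nablaAux_koszul {x : M} {X Y Z : VField M} (hX : FieldDiffAt X x) (hY : FieldDiffAt Y x)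
    (hZ : FieldDiffAt Z x) :
    2 * g.val x (g.nablaAux hY (X x)) (Z x) = g.koszul X Y Z x := by
  have h := TensorialAt.mkHom₂_apply (I := 𝓡 4) (F := E4) (F' := E4)
    (Φ := fun X Z ↦ g.koszul X Y Z x) (x := x)
    (fun _ hZ ↦ g.koszul_tensorial₁ hY hZ) (fun _ hX ↦ g.koszul_tensorial₃ hX hY) hX hZ
  rw [← h]
  set A := TensorialAt.mkHom₂ (I := 𝓡 4) (F := E4) (F' := E4) (fun X Z ↦ g.koszul X Y Z x) x
        (fun _ hZ ↦ g.koszul_tensorial₁ hY hZ)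
        (fun _ hX ↦ g.koszul_tensorial₃ hX hY) with hA
  have h1 : g.nablaAux hY (X x) = (1 / 2 : ℝ) • (g.flat x).symm (A (X x)) := rfl
  have h2 : g.val x ((g.flat x).symm (A (X x))) = A (X x) := (g.flat x).apply_symm_apply _
  rw [h1, map_smul, smul_apply, h2, smul_eq_mul]
  ring

open Classical in
/-- The Levi-Civita connection of the metric: `g.leviCivita Y x v` is `∇_v Y`, with the value `0`
where `Y` is not differentiable. -/
def leviCivita : CovariantDerivative (𝓡 4) E4 (TangentSpace (𝓡 4) : M → Type) where
  toFun Y x := if hY : FieldDiffAt Y x then g.nablaAux hY else 0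
  isCovariantDerivativeOnUniv := by
    have key : ∀ {x : M} {A B : TangentSpace (𝓡 4) x →L[ℝ] TangentSpace (𝓡 4) x},
        (∀ X Z : VField M, FieldDiffAt X x → FieldDiffAt Z x →
          g.val x (A (X x)) (Z x) = g.val x (B (X x)) (Z x)) → A = B := by
      intro x A B h
      apply VectorBundle.injective_eval_mdifferentiableAt_sec (𝓡 4) E4 (TangentSpace (𝓡 4))
      ext1 X; ext1 hX
      have : g.val x (A (X x)) = g.val x (B (X x)) := by
        apply VectorBundle.injective_eval_mdifferentiableAt_sec (𝓡 4) E4 (TangentSpace (𝓡 4))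
        ext1 Z; ext1 hZ
        exact h X Z hX hZ
      exact (g.flat x).injective this
    constructor
    · intro Y Y' x hY hY' _
      have hs : FieldDiffAt (Y + Y') x := mdifferentiableAt_add_section hY hY'
      rw [dif_pos hY, dif_pos hY', dif_pos hs]
      refine key fun X Z hX hZ ↦ ?_
      have h1 := g.nablaAux_koszul hX hs hZ
      have h2 := g.nablaAux_koszul hX hY hZ
      have h3 := g.nablaAux_koszul hX hY' hZ
      rw [g.koszul_add hX hY hY' hZ] at h1
      rw [add_apply, map_add, add_apply]
      linarith
    · intro Y f x hY hf _
      have hs : FieldDiffAt (f • Y) x := hf.smul_section hY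
      rw [dif_pos hY, dif_pos hs]
      refine key fun X Z hX hZ ↦ ?_
      have h1 := g.nablaAux_koszul hX hs hZ
      have h2 := g.nablaAux_koszul hX hY hZ
      rw [g.koszul_smul hf hX hY hZ, ← h2] at h1
      simp only [add_apply, smul_apply, map_add, map_smul, ContinuousLinearMap.smulRight_apply,
        smul_eq_mul]
      change _ = f x * _ + diff f x (X x) * _
      linarith

/-- The Koszul formula. -/
theorem leviCivita_koszul {x : M} {X Y Z : VField M} (hX : FieldDiffAt X x) (hY : FieldDiffAt Y x)
    (hZ : FieldDiffAt Z x) :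
    2 * g.val x (g.leviCivita Y x (X x)) (Z x) = g.koszul X Y Z x := by
  have h : g.leviCivita Y x = g.nablaAux hY := dif_pos hY
  rw [h, g.nablaAux_koszul hX hY hZ]

/-- The Levi-Civita connection is compatible with the metric. -/
theorem leviCivita_metric {x : M} {X Y Z : VField M} (hX : FieldDiffAt X x) (hY : FieldDiffAt Y x)
    (hZ : FieldDiffAt Z x) :
    diff (fun y ↦ g.val y (Y y) (Z y)) x (X x)
      = g.val x (g.leviCivita Y x (X x)) (Z x) + g.val x (Y x) (g.leviCivita Z x (X x)) := by
  have h1 := g.leviCivita_koszul hX hY hZ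
  have h2 := g.leviCivita_koszul hX hZ hY
  have e : (fun y ↦ g.val y (Z y) (Y y)) = fun y ↦ g.val y (Y y) (Z y) := by
    ext y; exact g.symm y _ _
  have e' := VectorField.mlieBracket_swap_apply (I := 𝓡 4) (V := Y) (W := Z) (x := x)
  simp only [koszul] at h1 h2
  rw [e] at h2
  rw [e', g.val_neg_left] at h1
  rw [g.symm x (Y x)]
  linarith

/-- The Levi-Civita connection is torsion-free. -/
theorem leviCivita_torsion : (g.leviCivita).torsion = 0 := by
  rw [CovariantDerivative.torsion_eq_zero_iff]
  intro X Y x hX hY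
  apply (g.flat x).injective
  apply VectorBundle.injective_eval_mdifferentiableAt_sec (𝓡 4) E4 (TangentSpace (𝓡 4))
  ext1 Z; ext1 hZ
  have h1 := g.leviCivita_koszul hX hY hZ
  have h2 := g.leviCivita_koszul hY hX hZ
  have e : (fun y ↦ g.val y (Y y) (X y)) = fun y ↦ g.val y (X y) (Y y) := by
    ext y; exact g.symm y _ _
  have e' := VectorField.mlieBracket_swap_apply (I := 𝓡 4) (V := Y) (W := X) (x := x)
  simp only [koszul] at h1 h2
  rw [e, e', g.val_neg_left] at h2
  change g.val x (_ - _) (Z x) = g.val x _ (Z x)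
  rw [map_sub, sub_apply]
  linarith

/-- The divergence `∇ · X` of a vector field. -/
def div (X : VField M) (x : M) : ℝ :=
  LinearMap.trace ℝ (TangentSpace (𝓡 4) x) (g.leviCivita X x).toLinearMap

/-- For a tensor field `S` of type `(1,1)` (an endomorphism of each tangent space), `Y` a vector
field and `x` a point, the value at `x` of `(∇ · S)(Y) = (∇_a S^a_b) Y^b`: the trace of
`X ↦ (∇_X S) Y = ∇_X (S Y) - S (∇_X Y)`. -/
def divTensor (S : ∀ x : M, TangentSpace (𝓡 4) x →L[ℝ] TangentSpace (𝓡 4) x) (Y : VField M)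
    (x : M) : ℝ :=
  LinearMap.trace ℝ (TangentSpace (𝓡 4) x)
    ((g.leviCivita (fun y ↦ S y (Y y)) x).toLinearMap
      - (S x).toLinearMap ∘ₗ (g.leviCivita Y x).toLinearMap)

/-- The tensor `T = (ρ + p) u ⊗ u + p g` with its first index raised,
`T^a_b = (ρ + p) u^a u_b + p δ^a_b`. -/
def energyTensor (u : VField M) (ρ p : M → ℝ) (x : M) :
    TangentSpace (𝓡 4) x →L[ℝ] TangentSpace (𝓡 4) x :=
  (ρ x + p x) • (g.val x (u x)).smulRight (u x) + p x • ContinuousLinearMap.id ℝ _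

end LorentzMetric

/-! ### Perfect energy tensors -/

/-- A perfect energy tensor in the space-time `(M, g)`: unit velocity `u`, energy density `ρ` and
pressure `p` such that `T = (ρ + p) u ⊗ u + p g` is divergence-free. -/
structure PerfectEnergyTensor (g : LorentzMetric M) where
  /-- the unit velocity -/
  u : VField M
  /-- the energy density -/
  ρ : M → ℝ
  /-- the pressure -/
  p : M → ℝ
  smooth_u : SmoothField u
  smooth_ρ : SmoothFun ρ
  smooth_p : SmoothFun p
  unit : ∀ x, g.val x (u x) (u x) = -1
  conserved : ∀ (x : M) (Y : VField M), FieldDiffAt Y x →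
    g.divTensor (g.energyTensor u ρ p) Y x = 0

namespace PerfectEnergyTensor

variable {g : LorentzMetric M} (T : PerfectEnergyTensor g)

/-- The derivative `q̇ = u(q)` of a scalar function along the unit velocity. -/
def dot (q : M → ℝ) (x : M) : ℝ := diff q x (T.u x)

/-- `T` is barotropic if `dρ ∧ dp = 0` on the whole space-time domain. -/
def IsBarotropic : Prop :=
  ∀ (x : M) (v w : TangentSpace (𝓡 4) x),
    diff T.ρ x v * diff T.p x w - diff T.ρ x w * diff T.p x v = 0

/-- The indicatrix function `χ = ṗ / ρ̇`. -/
def indicatrix (x : M) : ℝ := T.dot T.p x / T.dot T.ρ x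

/-- `T` evolves in local thermal equilibrium with matter density `n`, specific internal energy
`ε`, temperature `Θ` and specific entropy `s`. -/
structure IsLTE (n ε Θ s : M → ℝ) : Prop where
  smooth_n : SmoothFun n
  smooth_ε : SmoothFun ε
  smooth_Θ : SmoothFun Θ
  smooth_s : SmoothFun s
  n_pos : ∀ x, 0 < n x
  Θ_pos : ∀ x, 0 < Θ x
  energy : ∀ x, T.ρ x = n x * (1 + ε x)
  matter : ∀ x, g.div (n • T.u) x = 0
  lte : ∀ x, Θ x • diff s x = diff ε x + T.p x • diff (fun y ↦ 1 / n y) x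

/-- `T` evolves in local thermal equilibrium, and its thermodynamic quantities are those of a
classical ideal gas with constant `k = k_B / m` and heat capacity at constant volume `cv`. -/
structure IsCIG (k cv : ℝ) (n ε Θ s : M → ℝ) : Prop extends T.IsLTE n ε Θ s where
  k_pos : 0 < k
  cv_pos : 0 < cv
  ideal : ∀ x, T.p x = k * n x * Θ x
  caloric : ∀ x, ε x = cv * Θ x

/-- `T` represents the evolution in local thermal equilibrium of a classical ideal gas with
adiabatic index `γ = 1 + k / cv`. -/
def RepresentsCIG (γ : ℝ) : Prop :=
  ∃ k cv : ℝ, γ = 1 + k / cv ∧ ∃ n ε Θ s : M → ℝ, T.IsCIG k cv n ε Θ s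

end PerfectEnergyTensor

end PerfectFluid

end

/-!
The proof rests on two observations about a conserved perfect energy tensor.

The first is the energy equation `ρ̇ + (ρ + p) ∇·u = 0` (`energy_equation`). As `u` is an
eigenvector of the energy tensor, with eigenvalue `-ρ`, the component of `∇·T = 0` along `u`
only involves `∇·(ρu)`, `∇·u` and `g(u, ∇_u u) = 0`. Since `ρ̇ ≠ 0`, it gives `ρ + p ≠ 0` and
`∇·u = -ρ̇ / (ρ + p)`.

The equations `ρ = n(1 + ε)`, `p = knΘ`, `ε = c_v Θ` of a classical ideal gas are algebraic. With
`γ - 1 = k / c_v` they say that `n = ρ - p / (γ - 1)`, that `ε = p / ((γ - 1)ρ - p)` and that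
`Θ = ε / c_v`. Positivity of `k`, `c_v`, `n` and `Θ` then becomes `γ > 1`, `0 < p < (γ - 1)ρ`. With
this `n`, the energy equation turns the conservation of matter `∇·(nu) = 0` into
`χ = γp / (ρ + p)` (`div_matter_eq_zero_iff`), which proves part (a) up to the existence of an
entropy.

The second observation is that, with `w = (γ - 1)ρ - p`, the form `dε + p d(1/n)` is
`(p / w) d ln(p / w ^ γ)` (`gibbs_relation`). So `c_v ln(p / w ^ γ)` is an entropy, and any other
one has the same differential, hence differs from it by a constant on the connected manifold `M`
(`exists_eq_const_of_diff_eq_zero`). In part (b), the values of `χ` and `p > 0` determine `γ`, so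
every ideal gas that `T` represents has `γ = 1 + k / c_v`.
-/

noncomputable section

namespace PerfectFluid

/-! ### Differentials of scalar functions -/

section Differential

variable {M : Type*} [TopologicalSpace M] [ChartedSpace E4 M]

theorem SmoothFun.funDiffAt {f : M → ℝ} (hf : SmoothFun f) (x : M) : FunDiffAt f x :=
  hf.mdifferentiableAt (by simp)

theorem smoothFun_comp {φ : ℝ → ℝ} {f : M → ℝ} (hf : SmoothFun f)
    (hφ : ∀ x, ContDiffAt ℝ ∞ φ (f x)) : SmoothFun (fun y ↦ φ (f y)) :=
  fun x ↦ (hφ x).comp_contMDiffAt (hf x)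

theorem diff_comp {φ : ℝ → ℝ} {φ' : ℝ} {f : M → ℝ} {x : M} (hφ : HasDerivAt φ φ' (f x))
    (hf : FunDiffAt f x) (v : TangentSpace (𝓡 4) x) :
    diff (fun y ↦ φ (f y)) x v = φ' * diff f x v := by
  have h := HasMFDerivAt.comp (I := 𝓡 4) (I' := 𝓘(ℝ, ℝ)) (I'' := 𝓘(ℝ, ℝ)) x
    hφ.hasFDerivAt.hasMFDerivAt hf.hasMFDerivAt
  have h' : mfderiv (𝓡 4) 𝓘(ℝ, ℝ) (fun y ↦ φ (f y)) x = _ := h.mfderiv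
  change mfderiv (𝓡 4) 𝓘(ℝ, ℝ) (fun y ↦ φ (f y)) x v = φ' * diff f x v
  rw [h']
  exact mul_comm (diff f x v) φ'

theorem diff_const_mul {f : M → ℝ} {x : M} (hf : FunDiffAt f x) (c : ℝ)
    (v : TangentSpace (𝓡 4) x) : diff (fun y ↦ c * f y) x v = c * diff f x v :=
  diff_comp (φ := fun t ↦ c * t) (by simpa using (hasDerivAt_id (f x)).const_mul c) hf v

/-- A function with vanishing differential is constant on a connected manifold: in a chart it is
locally constant. -/
theorem exists_eq_const_of_diff_eq_zero [IsManifold (𝓡 4) ∞ M] [ConnectedSpace M] {f : M → ℝ}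
    (hf : SmoothFun f) (h : ∀ x, diff f x = 0) : ∃ c, ∀ x, f x = c := by
  have hloc : IsLocallyConstant f := by
    rw [IsLocallyConstant.iff_eventually_eq]
    intro x
    have hD : DifferentiableOn ℝ (f ∘ (extChartAt (𝓡 4) x).symm) (extChartAt (𝓡 4) x).target := by
      intro y hy
      have h1 : MDifferentiableAt 𝓘(ℝ, E4) 𝓘(ℝ, ℝ) (f ∘ (extChartAt (𝓡 4) x).symm) y :=
        (hf.funDiffAt _).comp y (mdifferentiableOn_extChartAt_symm.mdifferentiableAt
          ((isOpen_extChartAt_target x).mem_nhds hy))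
      exact h1.differentiableAt.differentiableWithinAt
    have hz : (extChartAt (𝓡 4) x).target.EqOn
        (fderiv ℝ (f ∘ (extChartAt (𝓡 4) x).symm)) 0 := by
      intro y hy
      have h1 := mfderiv_comp (I := 𝓘(ℝ, E4)) (I' := 𝓡 4) (I'' := 𝓘(ℝ, ℝ)) y
        (hf.funDiffAt ((extChartAt (𝓡 4) x).symm y))
        (mdifferentiableOn_extChartAt_symm.mdifferentiableAt
          ((isOpen_extChartAt_target x).mem_nhds hy))
      have h2 : mfderiv (𝓡 4) 𝓘(ℝ, ℝ) f ((extChartAt (𝓡 4) x).symm y) = 0 := h _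
      rw [h2, mfderiv_eq_fderiv] at h1
      rw [h1]
      ext v
      rfl
    have ho := (isOpen_extChartAt_target (I := 𝓡 4) x).isOpen_inter_preimage_of_fderiv_eq_zero
      hD hz {f x}
    have hn := (continuousAt_extChartAt (I := 𝓡 4) x).preimage_mem_nhds (ho.mem_nhds
      ⟨mem_extChartAt_target x, by simp⟩)
    filter_upwards [hn, extChartAt_source_mem_nhds (I := 𝓡 4) x] with y hy hys
    have h1 : f ((extChartAt (𝓡 4) x).symm (extChartAt (𝓡 4) x y)) = f x := hy.2
    rwa [(extChartAt (𝓡 4) x).left_inv hys] at h1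
  obtain ⟨x₀⟩ : Nonempty M := inferInstance
  exact ⟨f x₀, fun x ↦ hloc.apply_eq_of_preconnectedSpace x x₀⟩

/-- Gibbs' relation for the ideal gas: if `ε = p / w` and `1 / n = (γ - 1) / w`, then
`dε + p d(1/n) = ε d(ln (p / w ^ γ))`. -/
theorem gibbs_relation {p w : M → ℝ} (hp : SmoothFun p) (hw : SmoothFun w)
    (hp0 : ∀ x, 0 < p x) (hw0 : ∀ x, 0 < w x) (γ : ℝ) (x : M) (v : TangentSpace (𝓡 4) x) :
    diff (fun y ↦ p y / w y) x v + p x * diff (fun y ↦ (γ - 1) / w y) x v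
      = p x / w x * diff (fun y ↦ Real.log (p y / w y ^ γ)) x v := by
  have hpx := (hp0 x).ne'
  have hwx := (hw0 x).ne'
  have hinv : SmoothFun (fun y ↦ (w y)⁻¹) :=
    smoothFun_comp hw fun x ↦ contDiffAt_inv ℝ (hw0 x).ne'
  have hlp : SmoothFun (fun y ↦ Real.log (p y)) :=
    smoothFun_comp hp fun x ↦ Real.contDiffAt_log.2 (hp0 x).ne'
  have hlw : SmoothFun (fun y ↦ γ * Real.log (w y)) :=
    smoothFun_comp (φ := fun t ↦ γ * Real.log t) hw fun x ↦
      contDiffAt_const.mul (Real.contDiffAt_log.2 (hw0 x).ne')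
  have d1 : diff (fun y ↦ (w y)⁻¹) x v = -(w x ^ 2)⁻¹ * diff w x v :=
    diff_comp (hasDerivAt_inv hwx) (hw.funDiffAt x) v
  have d2 : diff (fun y ↦ Real.log (p y)) x v = (p x)⁻¹ * diff p x v :=
    diff_comp (Real.hasDerivAt_log hpx) (hp.funDiffAt x) v
  have d3 : diff (fun y ↦ γ * Real.log (w y)) x v = γ * (w x)⁻¹ * diff w x v :=
    diff_comp (φ := fun t ↦ γ * Real.log t) ((Real.hasDerivAt_log hwx).const_mul γ)
      (hw.funDiffAt x) v
  have e : (fun y ↦ Real.log (p y / w y ^ γ))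
      = fun y ↦ Real.log (p y) - γ * Real.log (w y) := by
    ext y
    rw [Real.log_div (hp0 y).ne' (Real.rpow_pos_of_pos (hw0 y) γ).ne', Real.log_rpow (hw0 y)]
  have d4 : diff (fun y ↦ Real.log (p y) - γ * Real.log (w y)) x v
      = (p x)⁻¹ * diff p x v - γ * (w x)⁻¹ * diff w x v := by
    rw [diff, mvfderiv_fun_sub (hlp.funDiffAt x) (hlw.funDiffAt x), sub_apply, d2, d3]
  have d5 : diff (fun y ↦ p y * (w y)⁻¹) x v
      = p x * (-(w x ^ 2)⁻¹ * diff w x v) + (w x)⁻¹ * diff p x v := by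
    rw [diff, mvfderiv_fun_mul (hp.funDiffAt x) (hinv.funDiffAt x), add_apply, smul_apply,
      smul_apply, d1, smul_eq_mul, smul_eq_mul]
  rw [e]
  simp only [div_eq_mul_inv]
  rw [d4, d5, diff_const_mul (hinv.funDiffAt x), d1]
  field_simp
  ring

end Differential

/-! ### The energy equation and the conservation of matter -/

variable {M : Type*} [TopologicalSpace M] [ChartedSpace E4 M] [IsManifold (𝓡 4) ∞ M]

theorem LorentzMetric.div_smul (g : LorentzMetric M) {f : M → ℝ} {X : VField M} {x : M}
    (hf : FunDiffAt f x) (hX : FieldDiffAt X x) :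
    g.div (f • X) x = diff f x (X x) + f x * g.div X x := by
  have h := g.leviCivita.isCovariantDerivativeOnUniv.leibniz hX hf
  have h' : (g.leviCivita (f • X) x).toLinearMap
      = f x • (g.leviCivita X x).toLinearMap
        + (diff f x).toLinearMap.smulRight (X x) := by
    ext v
    exact congrArg (fun A ↦ A v) h
  have : FiniteDimensional ℝ (TangentSpace (𝓡 4) x) := inferInstanceAs (FiniteDimensional ℝ E4)
  rw [div, h', map_add, map_smul, LinearMap.trace_smulRight, div, smul_eq_mul, add_comm]
  rfl

namespace PerfectEnergyTensor

variable {g : LorentzMetric M} (T : PerfectEnergyTensor g)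

theorem fieldDiffAt_u (x : M) : FieldDiffAt T.u x := T.smooth_u.mdifferentiableAt (by simp)

/-- The acceleration `∇_u u` of the unit field `u` is orthogonal to `u`. -/
theorem val_leviCivita_u (x : M) : g.val x (T.u x) (g.leviCivita T.u x (T.u x)) = 0 := by
  have hu := T.fieldDiffAt_u x
  have h := g.leviCivita_metric hu hu hu
  have e : (fun y ↦ g.val y (T.u y) (T.u y)) = fun _ ↦ (-1 : ℝ) := funext T.unit
  rw [e, diff, mvfderiv_const, g.symm x (g.leviCivita T.u x (T.u x))] at h
  have h0 : (0 : TangentSpace (𝓡 4) x →L[ℝ] ℝ) (T.u x) = 0 := rfl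
  rw [h0] at h
  linarith

/-- The energy equation, which is the component of `∇ · T = 0` along `u`. -/
theorem energy_equation (x : M) :
    T.dot T.ρ x + (T.ρ x + T.p x) * g.div T.u x = 0 := by
  have hu := T.fieldDiffAt_u x
  have hρ := T.smooth_ρ.funDiffAt x
  have hc := T.conserved x T.u hu
  -- `u` is an eigenvector of `T`, with eigenvalue `-ρ`.
  have e : (fun y ↦ g.energyTensor T.u T.ρ T.p y (T.u y)) = (fun y ↦ -1 * T.ρ y) • T.u := by
    ext1 y
    change (T.ρ y + T.p y) • (g.val y (T.u y) (T.u y) • T.u y) + T.p y • T.u y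
      = (-1 * T.ρ y) • T.u y
    rw [T.unit, smul_smul, ← add_smul]
    congr 1
    ring
  have hS : (g.energyTensor T.u T.ρ T.p x).toLinearMap ∘ₗ (g.leviCivita T.u x).toLinearMap
      = (T.ρ x + T.p x) • ((g.val x (T.u x)).toLinearMap
          ∘ₗ (g.leviCivita T.u x).toLinearMap).smulRight (T.u x)
        + T.p x • (g.leviCivita T.u x).toLinearMap := rfl
  have hneg : FunDiffAt (fun y ↦ -1 * T.ρ y) x := mdifferentiableAt_const.mul hρ
  have hd := g.div_smul hneg hu
  rw [diff_const_mul hρ] at hd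
  have : FiniteDimensional ℝ (TangentSpace (𝓡 4) x) := inferInstanceAs (FiniteDimensional ℝ E4)
  rw [LorentzMetric.divTensor, e, hS, map_sub, map_add, map_smul, map_smul,
    LinearMap.trace_smulRight] at hc
  have ha := T.val_leviCivita_u x
  change LorentzMetric.div g _ x - ((T.ρ x + T.p x) •
    g.val x (T.u x) (g.leviCivita T.u x (T.u x)) + T.p x • g.div T.u x) = 0 at hc
  rw [hd, ha, smul_eq_mul, smul_eq_mul] at hc
  rw [dot]
  linarith

theorem energy_add_pressure_ne_zero {x : M} (h : T.dot T.ρ x ≠ 0) : T.ρ x + T.p x ≠ 0 := by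
  intro h0
  have := T.energy_equation x
  rw [h0] at this
  exact h (by linarith)

/-- For the matter density of an ideal gas of adiabatic index `γ`, conservation of matter amounts to
the ideal form of the indicatrix function. -/
theorem div_matter_eq_zero_iff {γ : ℝ} (hγ : γ - 1 ≠ 0) {x : M} (h : T.dot T.ρ x ≠ 0) :
    g.div ((fun y ↦ T.ρ y - T.p y / (γ - 1)) • T.u) x = 0 ↔
      T.indicatrix x = γ * T.p x / (T.ρ x + T.p x) := by
  have hρ := T.smooth_ρ.funDiffAt x
  have hp := T.smooth_p.funDiffAt x
  have hn := T.energy_add_pressure_ne_zero h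
  have hθ : g.div T.u x = -T.dot T.ρ x / (T.ρ x + T.p x) := by
    rw [eq_div_iff hn]
    linarith [T.energy_equation x]
  have hcp : FunDiffAt (fun y ↦ (γ - 1)⁻¹ * T.p y) x := mdifferentiableAt_const.mul hp
  have e : (fun y ↦ T.ρ y - T.p y / (γ - 1)) = fun y ↦ T.ρ y - (γ - 1)⁻¹ * T.p y := by
    ext y; ring
  have hd : diff (fun y ↦ T.ρ y - (γ - 1)⁻¹ * T.p y) x (T.u x)
      = T.dot T.ρ x - (γ - 1)⁻¹ * T.dot T.p x := by
    rw [diff, mvfderiv_fun_sub hρ hcp, sub_apply]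
    exact congrArg _ (diff_const_mul hp _ _)
  have hn' : FunDiffAt (fun y ↦ T.ρ y - (γ - 1)⁻¹ * T.p y) x := hρ.sub hcp
  rw [e, g.div_smul hn' (T.fieldDiffAt_u x), hd, hθ, indicatrix, div_eq_div_iff h hn]
  field_simp
  constructor <;> intro h' <;> linarith

/-! ### The thermodynamic quantities of an ideal gas -/

/-- The equations of state alone give the positivity constraints and the matter density; here
`k / cv` stands for `γ - 1`. -/
theorem IsCIG.gas_relations {T : PerfectEnergyTensor g} {k cv : ℝ} {n ε Θ s : M → ℝ}
    (h : T.IsCIG k cv n ε Θ s) (x : M) :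
    0 < T.p x ∧ T.p x < k / cv * T.ρ x ∧ n x = T.ρ x - T.p x / (k / cv) := by
  have hk := h.k_pos
  have hc := h.cv_pos
  have hn := h.n_pos x
  have hΘ := h.Θ_pos x
  rw [h.energy x, h.ideal x, h.caloric x]
  refine ⟨by positivity, ?_, ?_⟩
  · have : k / cv * (n x * (1 + cv * Θ x)) = k / cv * n x + k * n x * Θ x := by
      field_simp
    rw [this]
    have : 0 < k / cv * n x := by positivity
    linarith
  · field_simp
    ring

theorem IsCIG.indicatrix_eq {T : PerfectEnergyTensor g} {k cv : ℝ} {n ε Θ s : M → ℝ}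
    (h : T.IsCIG k cv n ε Θ s) {x : M} (hx : T.dot T.ρ x ≠ 0) :
    T.indicatrix x = (1 + k / cv) * T.p x / (T.ρ x + T.p x) := by
  have hkc : 0 < k / cv := div_pos h.k_pos h.cv_pos
  rw [← T.div_matter_eq_zero_iff (by simpa using hkc.ne') hx, add_sub_cancel_left,
    ← funext fun y ↦ (h.gas_relations y).2.2]
  exact h.matter x

/-- The specific entropy `cv ln(p / ((γ - 1)ρ - p) ^ γ)` of an ideal gas of heat capacity `cv` and
adiabatic index `γ`, with additive constant `0`. -/
def gasEntropy (cv γ : ℝ) (x : M) : ℝ :=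
  cv * Real.log (T.p x / (T.ρ x * (γ - 1) - T.p x) ^ γ)


section Gas

variable {T} {γ : ℝ}

theorem smooth_gasEntropy (hpos : ∀ x, 0 < T.p x ∧ T.p x < (γ - 1) * T.ρ x) (cv : ℝ) :
    SmoothFun (T.gasEntropy cv γ) := by
  have hw : SmoothFun (fun y ↦ T.ρ y * (γ - 1) - T.p y) :=
    (T.smooth_ρ.mul contMDiff_const).sub T.smooth_p
  have hw0 : ∀ x, 0 < T.ρ x * (γ - 1) - T.p x := fun x ↦ by linarith [(hpos x).2]
  have e : T.gasEntropy cv γ = fun y ↦ cv * Real.log (T.p y)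
      - cv * (γ * Real.log (T.ρ y * (γ - 1) - T.p y)) := by
    ext y
    rw [gasEntropy, Real.log_div (hpos y).1.ne' (Real.rpow_pos_of_pos (hw0 y) γ).ne',
      Real.log_rpow (hw0 y)]
    ring
  rw [e]
  exact (smoothFun_comp (φ := fun t ↦ cv * Real.log t) T.smooth_p fun x ↦
    contDiffAt_const.mul (Real.contDiffAt_log.2 (hpos x).1.ne')).sub
    (smoothFun_comp (φ := fun t ↦ cv * (γ * Real.log t)) hw fun x ↦
      contDiffAt_const.mul (contDiffAt_const.mul (Real.contDiffAt_log.2 (hw0 x).ne')))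

/-- The local thermal equilibrium relation holds with `gasEntropy` as specific entropy. -/
theorem temperature_smul_diff_gasEntropy (hγ : 1 < γ)
    (hpos : ∀ x, 0 < T.p x ∧ T.p x < (γ - 1) * T.ρ x) {cv : ℝ} (hcv : cv ≠ 0) (x : M) :
    (T.p x / ((γ - 1) * T.ρ x - T.p x) / cv) • diff (T.gasEntropy cv γ) x
      = diff (fun y ↦ T.p y / ((γ - 1) * T.ρ y - T.p y)) x
        + T.p x • diff (fun y ↦ 1 / (T.ρ y - T.p y / (γ - 1))) x := by
  have hw : SmoothFun (fun y ↦ (γ - 1) * T.ρ y - T.p y) :=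
    (contMDiff_const.mul T.smooth_ρ).sub T.smooth_p
  have hw0 : ∀ x, 0 < (γ - 1) * T.ρ x - T.p x := fun x ↦ sub_pos.2 (hpos x).2
  have hγ0 : γ - 1 ≠ 0 := (sub_pos.2 hγ).ne'
  have e : (fun y ↦ 1 / (T.ρ y - T.p y / (γ - 1)))
      = fun y ↦ (γ - 1) / ((γ - 1) * T.ρ y - T.p y) := by
    ext y
    have h1 : T.ρ y - T.p y / (γ - 1) = ((γ - 1) * T.ρ y - T.p y) / (γ - 1) := by
      field_simp
    rw [h1, one_div_div]
  have e' : T.gasEntropy cv γ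
      = fun y ↦ cv * Real.log (T.p y / ((γ - 1) * T.ρ y - T.p y) ^ γ) := by
    ext y
    rw [gasEntropy, mul_comm (γ - 1)]
  have hlog : SmoothFun (fun y ↦ Real.log (T.p y / ((γ - 1) * T.ρ y - T.p y) ^ γ)) := by
    have h1 : SmoothFun (fun y ↦ 1 * Real.log (T.p y / (T.ρ y * (γ - 1) - T.p y) ^ γ)) :=
      smooth_gasEntropy hpos 1
    simpa only [one_mul, mul_comm (γ - 1)] using h1
  ext v
  rw [add_apply, smul_apply, smul_apply, smul_eq_mul, smul_eq_mul, e, e',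
    gibbs_relation T.smooth_p hw (fun x ↦ (hpos x).1) hw0, diff_const_mul (hlog.funDiffAt x)]
  field_simp

/-- Under the positivity constraints, if the indicatrix function has the ideal form, then every
choice of heat capacity and entropy constant defines an ideal gas. -/
theorem isCIG_of_indicatrix_eq (hγ : 1 < γ) (hpos : ∀ x, 0 < T.p x ∧ T.p x < (γ - 1) * T.ρ x)
    (hiso : ∀ x, T.dot T.ρ x ≠ 0)
    (hχ : ∀ x, T.indicatrix x = γ * T.p x / (T.ρ x + T.p x)) {cv : ℝ} (hcv : 0 < cv) (s₀ : ℝ) :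
    T.IsCIG ((γ - 1) * cv) cv (fun x ↦ T.ρ x - T.p x / (γ - 1))
      (fun x ↦ T.p x / ((γ - 1) * T.ρ x - T.p x))
      (fun x ↦ T.p x / ((γ - 1) * T.ρ x - T.p x) / cv)
      (fun x ↦ s₀ + T.gasEntropy cv γ x) := by
  have hγ0 : 0 < γ - 1 := sub_pos.2 hγ
  have hw : SmoothFun (fun y ↦ (γ - 1) * T.ρ y - T.p y) :=
    (contMDiff_const.mul T.smooth_ρ).sub T.smooth_p
  have hw0 : ∀ x, 0 < (γ - 1) * T.ρ x - T.p x := fun x ↦ sub_pos.2 (hpos x).2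
  have hε : SmoothFun (fun y ↦ T.p y / ((γ - 1) * T.ρ y - T.p y)) := by
    simp only [div_eq_mul_inv]
    exact T.smooth_p.mul (smoothFun_comp hw fun x ↦ contDiffAt_inv ℝ (hw0 x).ne')
  have hS := smooth_gasEntropy hpos cv
  have hn : ∀ x, T.ρ x - T.p x / (γ - 1) = ((γ - 1) * T.ρ x - T.p x) / (γ - 1) := fun x ↦ by
    field_simp
  refine
    { smooth_n := ?_
      smooth_ε := hε
      smooth_Θ := ?_
      smooth_s := contMDiff_const.add hS
      n_pos := fun x ↦ ?_
      Θ_pos := fun x ↦ div_pos (div_pos (hpos x).1 (hw0 x)) hcv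
      energy := fun x ↦ ?_
      matter := fun x ↦ (T.div_matter_eq_zero_iff hγ0.ne' (hiso x)).2 (hχ x)
      lte := fun x ↦ ?_
      k_pos := mul_pos hγ0 hcv
      cv_pos := hcv
      ideal := fun x ↦ ?_
      caloric := fun x ↦ ?_ }
  · simp only [div_eq_mul_inv]
    exact T.smooth_ρ.sub (T.smooth_p.mul contMDiff_const)
  · simp only [div_eq_mul_inv _ cv]
    exact hε.mul contMDiff_const
  · rw [hn]
    exact div_pos (hw0 x) hγ0
  · have hwx := (hw0 x).ne'
    rw [hn, one_add_div hwx, sub_add_cancel, div_mul_div_comm, mul_comm (γ - 1) (_ - _),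
      mul_div_mul_left _ _ hwx, mul_div_cancel_left₀ _ hγ0.ne']
  · rw [← temperature_smul_diff_gasEntropy hγ hpos hcv.ne' x, diff,
      mvfderiv_fun_add mdifferentiableAt_const (hS.funDiffAt x), mvfderiv_const, zero_add]
  · have := (hw0 x).ne'
    rw [hn]
    field_simp
  · field_simp

/-- An ideal gas represented by `T` has no freedom but the constants `k`, `cv` and the additive
constant of its entropy. -/
theorem IsCIG.eq_gas_quantities [ConnectedSpace M] {k cv : ℝ} {n ε Θ s : M → ℝ}
    (h : T.IsCIG k cv n ε Θ s) (hγ : γ = 1 + k / cv) :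
    (∀ x, n x = T.ρ x - T.p x / (γ - 1)) ∧
      (∀ x, ε x = T.p x / ((γ - 1) * T.ρ x - T.p x)) ∧
      (∀ x, Θ x = ε x / cv) ∧ ∃ s₀ : ℝ, ∀ x, s x = s₀ + T.gasEntropy cv γ x := by
  have hk := h.k_pos
  have hcv := h.cv_pos
  have hkc : 0 < k / cv := div_pos hk hcv
  have hγ' : γ - 1 = k / cv := by rw [hγ]; ring
  have hpos : ∀ x, 0 < T.p x ∧ T.p x < (γ - 1) * T.ρ x := fun x ↦ by
    rw [hγ']
    exact ⟨(h.gas_relations x).1, (h.gas_relations x).2.1⟩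
  have hn : ∀ x, n x = T.ρ x - T.p x / (γ - 1) := fun x ↦ by
    rw [hγ']
    exact (h.gas_relations x).2.2
  have hε : ∀ x, ε x = T.p x / ((γ - 1) * T.ρ x - T.p x) := fun x ↦ by
    have hw : (γ - 1) * T.ρ x - T.p x = k / cv * n x := by
      rw [hn x, ← hγ']
      have : γ - 1 ≠ 0 := by rw [hγ']; exact hkc.ne'
      field_simp
    have := (h.n_pos x).ne'
    rw [hw, h.ideal x, h.caloric x]
    field_simp
  have hΘ : ∀ x, Θ x = ε x / cv := fun x ↦ by
    rw [h.caloric x]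
    field_simp
  refine ⟨hn, hε, hΘ, ?_⟩
  have hS := smooth_gasEntropy hpos cv
  obtain ⟨c, hc⟩ := exists_eq_const_of_diff_eq_zero (f := fun x ↦ s x - T.gasEntropy cv γ x)
    (h.smooth_s.sub hS) fun x ↦ by
      have h1 := h.lte x
      rw [funext hε, funext hn, ← temperature_smul_diff_gasEntropy (by linarith) hpos hcv.ne' x,
        ← hε x, ← hΘ x] at h1
      rw [diff, mvfderiv_fun_sub (h.smooth_s.funDiffAt x) (hS.funDiffAt x), sub_eq_zero]
      exact smul_right_injective _ (h.Θ_pos x).ne' h1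
  exact ⟨c, fun x ↦ by linarith [hc x]⟩

end Gas

end PerfectEnergyTensor

end PerfectFluid

end

theorem theorem1 {M : Type*} [TopologicalSpace M] [ChartedSpace PerfectFluid.E4 M]
    [IsManifold (𝓡 4) ∞ M] [ConnectedSpace M]
    (g : PerfectFluid.LorentzMetric M) (T : PerfectFluid.PerfectEnergyTensor g)
    (hbar : ¬ T.IsBarotropic) (hiso : ∀ x, T.dot T.ρ x ≠ 0) (γ : ℝ) :
    (T.RepresentsCIG γ ↔
      (1 < γ ∧ ∀ x, 0 < T.p x ∧ T.p x < (γ - 1) * T.ρ x) ∧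
        ∀ x, T.indicatrix x = γ * T.p x / (T.ρ x + T.p x)) ∧
    (T.RepresentsCIG γ → ∀ (k cv : ℝ) (n ε Θ s : M → ℝ),
      T.IsCIG k cv n ε Θ s ↔
        0 < cv ∧ γ = 1 + k / cv ∧
        (∀ x, n x = T.ρ x - T.p x / (γ - 1)) ∧
        (∀ x, ε x = T.p x / ((γ - 1) * T.ρ x - T.p x)) ∧
        (∀ x, Θ x = ε x / cv) ∧
        ∃ s₀ : ℝ, ∀ x,
          s x = s₀ + cv * Real.log (T.p x / (T.ρ x * (γ - 1) - T.p x) ^ γ)) := by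
  have key : T.RepresentsCIG γ → (1 < γ ∧ ∀ x, 0 < T.p x ∧ T.p x < (γ - 1) * T.ρ x) ∧
      ∀ x, T.indicatrix x = γ * T.p x / (T.ρ x + T.p x) := by
    rintro ⟨k, cv, rfl, n, ε, Θ, s, h⟩
    have hkc : 0 < k / cv := div_pos h.k_pos h.cv_pos
    refine ⟨⟨by linarith, fun x ↦ ?_⟩, fun x ↦ h.indicatrix_eq (hiso x)⟩
    rw [add_sub_cancel_left]
    exact ⟨(h.gas_relations x).1, (h.gas_relations x).2.1⟩
  refine ⟨⟨key, ?_⟩, fun hT k cv n ε Θ s ↦ ?_⟩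
  · rintro ⟨⟨hγ, hpos⟩, hχ⟩
    exact ⟨(γ - 1) * 1, 1, by ring, _, _, _, _,
      PerfectFluid.PerfectEnergyTensor.isCIG_of_indicatrix_eq hγ hpos hiso hχ one_pos 0⟩
  · obtain ⟨⟨hγ, hpos⟩, hχ⟩ := key hT
    constructor
    · intro h
      -- The indicatrix function at any point determines the adiabatic index.
      have hγk : γ = 1 + k / cv := by
        obtain ⟨x⟩ : Nonempty M := inferInstance
        have h1 := (hχ x).symm.trans (h.indicatrix_eq (hiso x))
        exact mul_right_cancel₀ (hpos x).1.ne'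
          ((div_left_inj' (T.energy_add_pressure_ne_zero (hiso x))).1 h1)
      exact ⟨h.cv_pos, hγk, h.eq_gas_quantities hγk⟩
    · rintro ⟨hcv, hγk, hn, hε, hΘ, s₀, hs⟩
      have hk : k = (γ - 1) * cv := by
        rw [hγk]
        field_simp
        ring
      obtain rfl : n = _ := funext hn
      obtain rfl : ε = _ := funext hε
      obtain rfl : Θ = _ := funext hΘ
      obtain rfl : s = _ := funext hs
      rw [hk]
      exact PerfectFluid.PerfectEnergyTensor.isCIG_of_indicatrix_eq hγ hpos hiso hχ hcv s₀
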